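/- Let $n \ge 3$ be an integer and let $G_n$ be a simple plane triangulation on $2n+2$ vertices which has two non-adjacent vertices (the poles) of degree $n$ with no common neighbour, all other $2n$ vertices being of degree $5$. A $4$-colouring of $G_n$ is a proper colouring $A \colon V(G_n) \to \{1,2,3,4\}$ of its vertices; two $4$-colourings $A$, $B$ are identified if $A = P \circ B$ for some permutation $P$ of $\{1,2,3,4\}$. Let $|\mathcal{C}_4(G_n)|$ be the number of $4$-colourings of $G_n$ under this identification. Then $$|\mathcal{C}_4(G_n)| = \sum_{k \in \mathbb{Z},\ \frac n2 \le k < \frac{2n}{3}} \binom{k}{2n-3k}\,\frac{n\,2^{2n-3k}}{k} \qquad \text{if } n \not\equiv 0 \pmod 3,$$ and $$|\mathcal{C}_4(G_n)| = \sum_{k \in \mathbb{Z},\ \frac n2 \le k < \frac{2n}{3}} \binom{k}{2n-3k}\,\frac{n\,2^{2n-3k}}{k} + 4 \qquad \text{if } n \equiv 0 \pmod 3.$$ -/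

import Mathlib

namespace KempePoles

/-- An embedding of a finite connected simple graph in the plane (equivalently, in the sphere), up to
homeomorphism, given as a rotation system of genus zero: `rot` sends a dart (an edge with an orientation)
to the next dart in the cyclic order around its initial vertex, and Euler's formula holds. -/
structure PlaneEmbedding {V : Type*} [Fintype V] [DecidableEq V] (G : SimpleGraph V)
    [DecidableRel G.Adj] where
  connected : G.Connected
  rot : Equiv.Perm G.Dart
  rot_fst : ∀ d : G.Dart, (rot d).fst = d.fst
  rot_cyclic : ∀ d d' : G.Dart, d.fst = d'.fst → rot.SameCycle d d'
  /-- `V - E + F = 2`; the faces are the cycles of the permutation `d ↦ rot d.symm`,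
  which walks along the boundary of a face. -/
  euler : (Fintype.card V : ℤ) - (G.edgeFinset.card : ℤ)
    + (Nat.card (Quotient (Equiv.Perm.SameCycle.setoid
        (rot * SimpleGraph.Dart.symm_involutive.toPerm))) : ℤ) = 2

/-- The permutation of the darts whose cycles are the facial walks. -/
def PlaneEmbedding.faceStep {V : Type*} [Fintype V] [DecidableEq V] {G : SimpleGraph V}
    [DecidableRel G.Adj] (E : PlaneEmbedding G) : Equiv.Perm G.Dart :=
  E.rot * SimpleGraph.Dart.symm_involutive.toPerm

/-- Every face is bounded by a triangle. (In a simple graph `faceStep` has no fixed dart, so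
`faceStep ^ 3 = 1` says that each of its cycles has length exactly three.) -/
def PlaneEmbedding.IsTriangulation {V : Type*} [Fintype V] [DecidableEq V] {G : SimpleGraph V}
    [DecidableRel G.Adj] (E : PlaneEmbedding G) : Prop :=
  ∀ d : G.Dart, E.faceStep (E.faceStep (E.faceStep d)) = d

/-- `G` is a graph `G_n` with poles `a` and `b`: a simple plane triangulation with two non-adjacent
vertices `a`, `b` of degree `n` and `2n` further vertices, all of degree `5`, where the poles have
no common neighbour. -/
structure IsGn {V : Type*} [Fintype V] [DecidableEq V] (n : ℕ) (G : SimpleGraph V)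
    [DecidableRel G.Adj] (a b : V) : Prop where
  triangulation : ∃ E : PlaneEmbedding G, E.IsTriangulation
  card_eq : Fintype.card V = 2 * n + 2
  poles_ne : a ≠ b
  poles_not_adj : ¬ G.Adj a b
  degree_a : G.degree a = n
  degree_b : G.degree b = n
  degree_other : ∀ v : V, v ≠ a → v ≠ b → G.degree v = 5
  disjoint_nbrs : Disjoint (G.neighborSet a) (G.neighborSet b)

/-- Two 4-colourings `A`, `B` are equal up to the names of the colours: `A = P ∘ B` for a
permutation `P` of the colours. -/
def colouringSetoid {V : Type*} (G : SimpleGraph V) : Setoid (G.Coloring (Fin 4)) where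
  r A B := ∃ P : Equiv.Perm (Fin 4), ∀ v : V, A v = P (B v)
  iseqv :=
    { refl := fun _ => ⟨1, fun _ => rfl⟩
      symm := by
        rintro A B ⟨P, h⟩
        exact ⟨P⁻¹, fun v => by simp [h v]⟩
      trans := by
        rintro A B C ⟨P, h⟩ ⟨Q, k⟩
        exact ⟨P * Q, fun v => by simp [h v, k v]⟩ }

/-- The number of different 4-colourings of `G`, i.e. of classes of 4-colourings up to a permutation
of the four colours. -/
noncomputable def numColourings {V : Type*} (G : SimpleGraph V) : ℕ :=
  Nat.card (Quotient (colouringSetoid G))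

end KempePoles

/-! The poles and their neighbours exhaust the vertices, and degree 5 forces the rings `v`, `w`
around the poles to be joined as an antiprism. Along the zigzag `w 0, v 0, w 1, v 1, …`, a cyclic
sequence of length `2n`, ring vertices are adjacent exactly at distance one or two. So a colouring
is a choice of pole colours and a cyclic word with local constraints, counted by the trace of a
power of a transfer matrix.

If the poles agree (4 ways), the word uses three colours, any three consecutive ones distinct: 6
words if `3 ∣ n`, else none. If they differ (12 ways), each ring has its own third colour, written
`2` on both, so `2` may follow itself. That matrix has characteristic polynomial `x ^ 2 (x ^ 3 - 1)
(x ^ 4 - x - 2)`. The cubic factor gives the term for `3 ∣ n`; the power sums of the quartic are `3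
T(N) + 2 T(N - 4)`, with `T` the coefficients of `1 / (1 - x ^ 3 - 2 x ^ 4)`, and expanding `T`
gives the binomial sum.

Finally the 24 colour permutations act freely, since a triangle shows three colours. Key results:
`IsGn.exists_rings`, `IsGn.numColourings_eq`, `trace_zigzag_true`, `three_mul_tilings_add`. -/

namespace KempePoles
open Finset

/-! ### Transfer matrices and the traces of the zigzag matrices -/

/-- Cyclic sequences weighted by the entries of a matrix are counted by the trace of a power. -/
theorem matrix_pow_apply_eq_sum {S : Type*} [Fintype S] [DecidableEq S] (M : Matrix S S ℤ) (m : ℕ)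
    (x y : S) : (M ^ (m + 1)) x y =
      ∑ c : Fin (m + 1) → S, if c 0 = x then
        (∏ i : Fin m, M (c i.castSucc) (c i.succ)) * M (c (Fin.last m)) y else 0 := by
  induction m generalizing x y with
  | zero =>
    rw [← (Equiv.funUnique (Fin 1) S).symm.sum_comp]
    simp [Equiv.funUnique]
  | succ m ih =>
    rw [pow_succ', Matrix.mul_apply]
    symm
    rw [← (Fin.consEquiv (fun _ : Fin (m + 2) => S)).sum_comp, Fintype.sum_prod_type,
      Finset.sum_eq_single x (by intro b _ hb; simp [Fin.consEquiv, hb]) (by simp)]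
    simp_rw [ih, Finset.mul_sum]
    rw [Finset.sum_comm]
    refine Finset.sum_congr rfl fun c _ => ?_
    rw [Finset.sum_eq_single (c 0) (by intro b _ hb; simp [hb.symm]) (by simp)]
    rw [Fin.prod_univ_succ, ← Fin.succ_last]
    simp only [Fin.consEquiv, Equiv.coe_fn_mk, Fin.castSucc_zero, Fin.cons_zero, Fin.cons_succ,
      ← Fin.succ_castSucc, if_true]
    ring

theorem trace_pow_eq_sum_prod {S : Type*} [Fintype S] [DecidableEq S] (M : Matrix S S ℤ) (m : ℕ) :
    (M ^ (m + 1)).trace = ∑ c : Fin (m + 1) → S, ∏ i, M (c i) (c (i + 1)) := by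
  simp only [Matrix.trace, Matrix.diag, matrix_pow_apply_eq_sum]
  rw [Finset.sum_comm]
  refine Finset.sum_congr rfl fun c _ => ?_
  simp [Fin.prod_univ_castSucc]

theorem trace_pow_eq_card {S : Type*} [Fintype S] [DecidableEq S] (r : S → S → Prop)
    [DecidableRel r] (m : ℕ) :
    ((Matrix.of fun x y => if r x y then (1 : ℤ) else 0) ^ (m + 1)).trace =
      Nat.card {c : Fin (m + 1) → S // ∀ i, r (c i) (c (i + 1))} := by
  rw [trace_pow_eq_sum_prod, Nat.card_eq_fintype_card, Fintype.card_subtype]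
  simp only [Matrix.of_apply, Finset.prod_ite_zero, Finset.prod_const_one, Finset.mem_univ,
    true_imp_iff]
  simp

/-- Symbols allowed next to each other in the zigzag sequence of colours: if `s`, the symbol `2`
stands for the colour of the opposite pole, hence for two different colours at two consecutive
places. -/
def Compatible (s : Bool) (x y : Fin 3) : Prop := x ≠ y ∨ (s = true ∧ x = 2)

instance (s : Bool) : DecidableRel (Compatible s) := fun _ _ => by
  unfold Compatible; infer_instance

/-- The one-step transfer matrix of zigzag sequences. -/
def zigzag (s : Bool) : Matrix (Fin 3 × Fin 3) (Fin 3 × Fin 3) ℤ :=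
  Matrix.of fun p q => if p.2 = q.1 ∧ p.1 ≠ q.2 ∧ Compatible s p.1 p.2 ∧ Compatible s q.1 q.2
    then 1 else 0

/-- Two consecutive pairs of a zigzag sequence. -/
def ZigzagRel (s : Bool) (p q : Fin 3 × Fin 3) : Prop :=
  Compatible s p.1 p.2 ∧ Compatible s p.2 q.1 ∧ Compatible s q.1 q.2 ∧ p.1 ≠ q.1 ∧ p.2 ≠ q.2

instance (s : Bool) : DecidableRel (ZigzagRel s) := fun _ _ => by
  unfold ZigzagRel; infer_instance

theorem zigzag_apply (s : Bool) (p q : Fin 3 × Fin 3) : zigzag s p q =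
    if p.2 = q.1 ∧ p.1 ≠ q.2 ∧ Compatible s p.1 p.2 ∧ Compatible s q.1 q.2 then 1 else 0 := rfl

/-- Two single steps move from one pair of the word to the next disjoint pair; the intermediate
overlapping pair is forced, so no multiplicity arises. -/
theorem zigzag_sq (s : Bool) :
    zigzag s ^ 2 = Matrix.of fun p q => if ZigzagRel s p q then (1 : ℤ) else 0 := by
  ext p q
  rw [pow_two, Matrix.mul_apply, Matrix.of_apply]
  simp only [zigzag_apply]
  revert s p q
  decide +kernel

theorem zigzag_pow_succ (s : Bool) (k : ℕ) (x y : Fin 3 × Fin 3) :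
    (zigzag s ^ (k + 1)) x y = ∑ z, (zigzag s ^ k) x z * zigzag s z y := by
  rw [pow_succ, Matrix.mul_apply]

theorem zigzag_true_pow (k : ℕ) (x : Fin 3 × Fin 3) :
    let a := fun k y => (zigzag true ^ k) x y
    a (k + 1) (0, 0) = 0 ∧ a (k + 1) (1, 1) = 0 ∧
    a (k + 1) (0, 1) = a k (2, 0) ∧ a (k + 1) (1, 0) = a k (2, 1) ∧
    a (k + 1) (0, 2) = a k (1, 0) ∧ a (k + 1) (1, 2) = a k (0, 1) ∧
    a (k + 1) (2, 0) = a k (1, 2) + a k (2, 2) ∧ a (k + 1) (2, 1) = a k (0, 2) + a k (2, 2) ∧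
    a (k + 1) (2, 2) = a k (0, 2) + a k (1, 2) := by
  simp [zigzag_pow_succ, Fintype.sum_prod_type, Fin.sum_univ_three, zigzag_apply, Compatible]

theorem zigzag_false_pow (k : ℕ) (x : Fin 3 × Fin 3) :
    let a := fun k y => (zigzag false ^ k) x y
    a (k + 1) (0, 0) = 0 ∧ a (k + 1) (1, 1) = 0 ∧ a (k + 1) (2, 2) = 0 ∧
    a (k + 1) (0, 1) = a k (2, 0) ∧ a (k + 1) (1, 0) = a k (2, 1) ∧
    a (k + 1) (0, 2) = a k (1, 0) ∧ a (k + 1) (1, 2) = a k (0, 1) ∧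
    a (k + 1) (2, 0) = a k (1, 2) ∧ a (k + 1) (2, 1) = a k (0, 2) := by
  simp [zigzag_pow_succ, Fintype.sum_prod_type, Fin.sum_univ_three, zigzag_apply, Compatible]

/-- Two distinct symbols determine the next one, so the matrix permutes the six pairs of distinct
symbols in 3-cycles. -/
theorem trace_zigzag_false (k : ℕ) :
    (zigzag false ^ (k + 1)).trace = if 3 ∣ k + 1 then 6 else 0 := by
  have per : ∀ k, (zigzag false ^ (k + 4)).trace = (zigzag false ^ (k + 1)).trace := by
    intro k
    simp only [Matrix.trace, Matrix.diag, Fintype.sum_prod_type, Fin.sum_univ_three]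
    simp only [zigzag_false_pow]
  induction k using Nat.strong_induction_on with
  | _ k ih =>
    match k with
    | 0 | 1 | 2 =>
      simp only [Matrix.trace, Matrix.diag, Fintype.sum_prod_type, Fin.sum_univ_three]
      simp [zigzag_false_pow, pow_zero]
    | k + 3 =>
      rw [per, ih k (by omega)]
      simp [show k + 3 + 1 = k + 1 + 3 by ring]

/-- The recurrence belongs to `(x ^ 3 - 1) (x ^ 4 - x - 2)`; the extra shift by two accounts for the
eigenvalue 0. -/
theorem trace_zigzag_true_rec (k : ℕ) :
    (zigzag true ^ (k + 9)).trace = 2 * (zigzag true ^ (k + 6)).trace +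
      2 * (zigzag true ^ (k + 5)).trace - (zigzag true ^ (k + 3)).trace
      - 2 * (zigzag true ^ (k + 2)).trace := by
  simp only [Matrix.trace, Matrix.diag, Fintype.sum_prod_type, Fin.sum_univ_three]
  simp only [zigzag_true_pow]
  ring

theorem trace_zigzag_true_small :
    (zigzag true ^ 2).trace = 0 ∧ (zigzag true ^ 3).trace = 6 ∧ (zigzag true ^ 4).trace = 8 ∧
    (zigzag true ^ 5).trace = 0 ∧ (zigzag true ^ 6).trace = 6 ∧ (zigzag true ^ 7).trace = 14 ∧
    (zigzag true ^ 8).trace = 16 := by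
  simp only [Matrix.trace, Matrix.diag, Fintype.sum_prod_type, Fin.sum_univ_three]
  simp [zigzag_true_pow, pow_zero]

/-! ### Tilings and the binomial sum -/

/-- The coefficient of `x ^ N` in `(x ^ 3 + 2 x ^ 4) ^ k`. -/
def tilingTerm (k N : ℕ) : ℕ := if 3 * k ≤ N then k.choose (N - 3 * k) * 2 ^ (N - 3 * k) else 0

/-- The coefficient of `x ^ N` in `1 / (1 - x ^ 3 - 2 x ^ 4)`. -/
def tilings (N : ℕ) : ℕ := ∑ k ∈ range (N + 1), tilingTerm k N

theorem tilingTerm_eq_zero {k N : ℕ} (h : N < 3 * k) : tilingTerm k N = 0 := by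
  simp [tilingTerm, h]

theorem tilingTerm_succ (k N : ℕ) :
    tilingTerm (k + 1) (N + 4) = tilingTerm k (N + 1) + 2 * tilingTerm k N := by
  rcases lt_trichotomy (3 * k) (N + 1) with h | h | h
  · obtain ⟨j, rfl⟩ : ∃ j, N = 3 * k + j := ⟨N - 3 * k, by omega⟩
    simp only [tilingTerm, show 3 * (k + 1) ≤ 3 * k + j + 4 by omega,
      show 3 * k ≤ 3 * k + j + 1 by omega, show 3 * k ≤ 3 * k + j by omega, if_true,
      show 3 * k + j + 4 - 3 * (k + 1) = j + 1 by omega,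
      show 3 * k + j + 1 - 3 * k = j + 1 by omega, show 3 * k + j - 3 * k = j by omega,
      Nat.choose_succ_succ, pow_succ]
    ring
  · rw [tilingTerm_eq_zero (N := N) (by omega)]
    simp [tilingTerm, h, show 3 * (k + 1) = N + 4 by omega]
  · rw [tilingTerm_eq_zero (by omega), tilingTerm_eq_zero (by omega),
      tilingTerm_eq_zero (by omega)]

theorem tilings_eq_sum {N M : ℕ} (h : N < 3 * M) :
    tilings N = ∑ k ∈ range M, tilingTerm k N := by
  have key : ∀ {A B : ℕ}, A ≤ B → N < 3 * A →
      ∑ k ∈ range A, tilingTerm k N = ∑ k ∈ range B, tilingTerm k N := by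
    intro A B hAB hA
    refine Finset.sum_subset (by simpa using hAB) fun k _ hk => tilingTerm_eq_zero ?_
    simp only [Finset.mem_range] at hk
    omega
  rcases le_total (N + 1) M with hM | hM
  · exact key hM (by omega)
  · exact (key hM h).symm

theorem tilings_rec (N : ℕ) : tilings (N + 4) = tilings (N + 1) + 2 * tilings N := by
  rw [tilings, Finset.sum_range_succ', tilings_eq_sum (N := N + 1) (M := N + 4) (by omega),
    tilings_eq_sum (N := N) (M := N + 4) (by omega), Finset.mul_sum, ← Finset.sum_add_distrib]
  simp only [tilingTerm_succ]
  simp [tilingTerm]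

/-- Both sides satisfy the order-seven recurrence, so agreement at the powers 4 to 10 suffices. -/
theorem trace_zigzag_true (N : ℕ) :
    (zigzag true ^ (N + 4)).trace =
      3 * tilings (N + 4) + 2 * tilings N + if 3 ∣ N + 4 then 3 else 0 := by
  obtain ⟨h2, h3, h4, h5, h6, h7, h8⟩ := trace_zigzag_true_small
  have h9 := trace_zigzag_true_rec 0
  have h10 := trace_zigzag_true_rec 1
  norm_num only at h9 h10
  have v : tilings 0 = 1 ∧ tilings 1 = 0 ∧ tilings 2 = 0 ∧ tilings 3 = 1 ∧ tilings 4 = 2 ∧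
      tilings 5 = 0 ∧ tilings 6 = 1 ∧ tilings 7 = 4 ∧ tilings 8 = 4 ∧ tilings 9 = 1 ∧
      tilings 10 = 6 := by decide
  rw [h6, h5, h3, h2] at h9
  rw [h7, h6, h4, h3] at h10
  induction N using Nat.strong_induction_on with
  | _ N ih =>
    match N with
    | 0 | 1 | 2 | 3 | 4 | 5 | 6 => simp [v, h4, h5, h6, h7, h8, h9, h10]
    | k + 7 =>
      have r := trace_zigzag_true_rec (k + 2)
      have i1 := ih (k + 4) (by omega)
      have i2 := ih (k + 3) (by omega)
      have i3 := ih (k + 1) (by omega)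
      have i4 := ih k (by omega)
      have t1 := tilings_rec k
      have t2 := tilings_rec (k + 1)
      have t3 := tilings_rec (k + 3)
      have t4 := tilings_rec (k + 4)
      have t5 := tilings_rec (k + 7)
      simp only [add_assoc, Nat.reduceAdd] at *
      split_ifs at * <;> omega

/-- With `j + 1 = 2n - 3(k + 1)`, the identity `(k + 1) C(k, j) = (j + 1) C(k + 1, j + 1)` turns the
left side into the factor `3 + (j + 1) / (k + 1) = 2n / (k + 1)`. The excluded index `k + 1 = 2n /
3` leaves the 3. -/
theorem three_mul_tilingTerm_add (n k : ℕ) (hn : 3 ≤ n) :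
    (3 * tilingTerm (k + 1) (2 * n) + 2 * tilingTerm k (2 * n - 4) : ℚ) =
      2 * (if n ≤ 2 * (k + 1) ∧ 3 * (k + 1) < 2 * n then
        (Nat.choose (k + 1) (2 * n - 3 * (k + 1)) : ℚ) *
          ((n : ℚ) * 2 ^ (2 * n - 3 * (k + 1)) / ((k + 1 : ℕ) : ℚ)) else 0) +
      if 3 * (k + 1) = 2 * n then 3 else 0 := by
  rcases lt_trichotomy (3 * (k + 1)) (2 * n) with h | h | h
  · obtain ⟨j, hj⟩ : ∃ j, 2 * n = 3 * (k + 1) + (j + 1) := ⟨2 * n - 3 * (k + 1) - 1, by omega⟩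
    have hc : (if n ≤ 2 * (k + 1) ∧ 3 * (k + 1) < 2 * n then
        (Nat.choose (k + 1) (2 * n - 3 * (k + 1)) : ℚ) *
          ((n : ℚ) * 2 ^ (2 * n - 3 * (k + 1)) / ((k + 1 : ℕ) : ℚ)) else 0) =
        (Nat.choose (k + 1) (2 * n - 3 * (k + 1)) : ℚ) *
          ((n : ℚ) * 2 ^ (2 * n - 3 * (k + 1)) / ((k + 1 : ℕ) : ℚ)) := by
      by_cases hk : n ≤ 2 * (k + 1)
      · rw [if_pos ⟨hk, h⟩]
      · rw [if_neg (by tauto), Nat.choose_eq_zero_of_lt (by omega)]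
        simp
    rw [hc, if_neg h.ne]
    simp only [tilingTerm, h.le, show 3 * k ≤ 2 * n - 4 by omega, if_true,
      show 2 * n - 3 * (k + 1) = j + 1 by omega, show 2 * n - 4 - 3 * k = j by omega]
    have hq : (2 * n : ℚ) = 3 * (k + 1) + (j + 1) := by exact_mod_cast hj
    have hch : ((k + 1 : ℕ) : ℚ) * k.choose j = (k + 1).choose (j + 1) * (j + 1) := by
      exact_mod_cast Nat.add_one_mul_choose_eq k j
    have hk0 : ((k + 1 : ℕ) : ℚ) ≠ 0 := by positivity
    have hn2 : (n : ℚ) = (3 * (k + 1) + (j + 1)) / 2 := by linarith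
    rw [hn2]
    push_cast at hch hk0 ⊢
    field_simp
    rw [pow_succ]
    linear_combination (2 * 2 ^ j) * hch
  · rw [tilingTerm_eq_zero (N := 2 * n - 4) (by omega)]
    simp [tilingTerm, h]
  · rw [tilingTerm_eq_zero (by omega), tilingTerm_eq_zero (by omega), if_neg (by omega),
      if_neg (by omega)]
    simp

theorem three_mul_tilings_add (n : ℕ) (hn : 3 ≤ n) :
    (3 * tilings (2 * n) + 2 * tilings (2 * n - 4) : ℚ) =
      2 * (∑ k ∈ range (2 * n) with n ≤ 2 * k ∧ 3 * k < 2 * n,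
        (Nat.choose k (2 * n - 3 * k) : ℚ) * ((n : ℚ) * 2 ^ (2 * n - 3 * k) / (k : ℚ))) +
      if 3 ∣ n then 3 else 0 := by
  obtain ⟨M, hM⟩ : ∃ M, 2 * n = M + 1 := ⟨2 * n - 1, by omega⟩
  have h0 : tilingTerm 0 (2 * n) = 0 := by
    simp [tilingTerm, Nat.choose_eq_zero_of_lt (show 0 < 2 * n by omega)]
  have hd : (∑ k ∈ range M, if 3 * (k + 1) = 2 * n then (3 : ℚ) else 0) =
      if 3 ∣ n then 3 else 0 := by
    split_ifs with h3
    · obtain ⟨q, rfl⟩ := h3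
      rw [Finset.sum_eq_single (2 * q - 1)]
      · rw [if_pos (by omega)]
      · intro k _ hk
        rw [if_neg (by omega)]
      · intro hk
        simp only [Finset.mem_range] at hk
        omega
    · refine Finset.sum_eq_zero fun k _ => if_neg ?_
      omega
  rw [Finset.sum_filter, tilings_eq_sum (N := 2 * n) (M := M + 1) (by omega),
    tilings_eq_sum (N := 2 * n - 4) (M := M) (by omega), ← hd]
  conv_rhs => rw [hM]
  rw [Finset.sum_range_succ', Finset.sum_range_succ', ← hM, h0, if_neg (by omega)]
  push_cast
  simp only [add_zero, Finset.mul_sum, ← Finset.sum_add_distrib]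
  exact Finset.sum_congr rfl fun k _ => by exact_mod_cast three_mul_tilingTerm_add n k hn

/-! ### Local structure of a plane triangulation -/

variable {V : Type*} [Fintype V] [DecidableEq V] {G : SimpleGraph V} [DecidableRel G.Adj]

/-- In the cyclic order around `u`, the neighbour `z` is followed by `w`. -/
def PlaneEmbedding.Next (E : PlaneEmbedding G) (u z w : V) : Prop :=
  ∃ d : G.Dart, d.fst = u ∧ d.snd = z ∧ (E.rot d).snd = w

namespace PlaneEmbedding

variable {E : PlaneEmbedding G} {u z w z' w' : V}

theorem Next.adj_left (h : E.Next u z w) : G.Adj u z := by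
  obtain ⟨d, rfl, rfl, -⟩ := h
  exact d.adj

theorem Next.adj_right (h : E.Next u z w) : G.Adj u w := by
  obtain ⟨d, rfl, -, rfl⟩ := h
  rw [← E.rot_fst d]
  exact (E.rot d).adj

theorem Next.unique_right (h : E.Next u z w) (h' : E.Next u z w') : w = w' := by
  obtain ⟨d, h1, h2, rfl⟩ := h
  obtain ⟨d', h1', h2', rfl⟩ := h'
  have : d = d' := SimpleGraph.Dart.ext _ _ (Prod.ext (h1.trans h1'.symm) (h2.trans h2'.symm))
  rw [this]

theorem Next.unique_left (h : E.Next u z w) (h' : E.Next u z' w) : z = z' := by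
  obtain ⟨d, h1, rfl, h3⟩ := h
  obtain ⟨d', h1', rfl, h3'⟩ := h'
  have : E.rot d = E.rot d' := SimpleGraph.Dart.ext _ _ (Prod.ext
    (((E.rot_fst d).trans h1).trans ((E.rot_fst d').trans h1').symm) (h3.trans h3'.symm))
  rw [E.rot.injective this]

theorem exists_next (E : PlaneEmbedding G) (h : G.Adj u z) : ∃ w, E.Next u z w :=
  ⟨_, ⟨(u, z), h⟩, rfl, rfl, rfl⟩

/-- A triangular face can be read from each of its corners. -/
theorem Next.rotate (hE : E.IsTriangulation) (h : E.Next u z w) : E.Next w u z := by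
  obtain ⟨d, rfl, rfl, rfl⟩ := h
  have h1 : E.faceStep d.symm = E.rot d := by
    change E.rot d.symm.symm = E.rot d
    rw [SimpleGraph.Dart.symm_symm]
  have h2 := hE d.symm
  rw [h1] at h2
  refine ⟨(E.rot d).symm, rfl, E.rot_fst d, ?_⟩
  have h3 : (E.faceStep (E.faceStep (E.rot d))).fst = (E.faceStep (E.rot d)).snd := E.rot_fst _
  rw [h2] at h3
  exact h3.symm

theorem rot_zpow_fst (E : PlaneEmbedding G) (d : G.Dart) (i : ℤ) :
    ((E.rot ^ i) d).fst = d.fst := by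
  induction i using Int.induction_on with
  | zero => rfl
  | succ i ih => rw [add_comm, zpow_add, zpow_one, Equiv.Perm.mul_apply, E.rot_fst, ih]
  | pred i ih =>
    rw [← ih, ← E.rot_fst ((E.rot ^ (-(i : ℤ) - 1)) d), ← Equiv.Perm.mul_apply, ← zpow_one_add,
      add_sub_cancel]

/-- The neighbours of a vertex, in cyclic order. -/
theorem exists_link (E : PlaneEmbedding G) (h : G.Adj u z) :
    ∃ s : ℤ → V, s 0 = z ∧ (∀ i, E.Next u (s i) (s (i + 1))) ∧
      (∀ i j, s i = s j ↔ (G.degree u : ℤ) ∣ i - j) ∧ ∀ x, G.Adj u x ↔ ∃ i, s i = x := by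
  classical
  set d : G.Dart := ⟨(u, z), h⟩ with hd
  have hfst : ∀ i : ℤ, ((E.rot ^ i) d).fst = u := fun i => E.rot_zpow_fst d i
  have horb : MulAction.orbit (Subgroup.zpowers E.rot) d = {d' : G.Dart | d'.fst = u} := by
    ext d'
    simp only [MulAction.mem_orbit_iff, Set.mem_ofPred_eq]
    constructor
    · rintro ⟨⟨_, i, rfl⟩, rfl⟩
      exact hfst i
    · intro h'
      obtain ⟨i, hi⟩ := E.rot_cyclic d d' (h'.symm)
      exact ⟨⟨_, i, rfl⟩, hi⟩
  have hper : Function.minimalPeriod (E.rot • ·) d = G.degree u := by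
    rw [MulAction.minimalPeriod_eq_card, ← Nat.card_eq_fintype_card, horb,
      ← G.dart_fst_fiber_card_eq_degree u, Nat.card_eq_fintype_card, Fintype.card_subtype]
    rfl
  have hss : ∀ i j : ℤ, ((E.rot ^ i) d).snd = ((E.rot ^ j) d).snd ↔
      (E.rot ^ i) d = (E.rot ^ j) d := fun i j =>
    ⟨fun e => SimpleGraph.Dart.ext _ _ (Prod.ext ((hfst i).trans (hfst j).symm) e), fun e => by rw [e]⟩
  refine ⟨fun i => ((E.rot ^ i) d).snd, rfl, fun i => ⟨(E.rot ^ i) d, hfst i, rfl, ?_⟩,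
    fun i j => ?_, fun x => ⟨fun hx => ?_, ?_⟩⟩
  · simp only [add_comm i, zpow_add, zpow_one, Equiv.Perm.mul_apply]
  · rw [hss, ← hper, ← MulAction.zpow_smul_eq_iff_minimalPeriod_dvd, Equiv.Perm.smul_def, sub_eq_neg_add,
      zpow_add, zpow_neg, Equiv.Perm.mul_apply, Equiv.Perm.inv_eq_iff_eq]
  · obtain ⟨i, hi⟩ := E.rot_cyclic d ⟨(u, x), hx⟩ rfl
    exact ⟨i, congrArg (fun d' : G.Dart => d'.snd) hi⟩
  · rintro ⟨i, rfl⟩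
    have := ((E.rot ^ i) d).adj
    rwa [hfst i] at this

/-- Five consecutive neighbours of a vertex of degree five. -/
theorem next_of_degree_five {z₀ z₁ z₂ z₃ z₄ : V} (hu : G.degree u = 5) (h₀ : E.Next u z₀ z₁)
    (h₁ : E.Next u z₁ z₂) (h₂ : E.Next u z₂ z₃) (h₃ : E.Next u z₃ z₄) :
    E.Next u z₄ z₀ ∧ [z₀, z₁, z₂, z₃, z₄].Nodup ∧
      ∀ x, G.Adj u x → x = z₀ ∨ x = z₁ ∨ x = z₂ ∨ x = z₃ ∨ x = z₄ := by
  obtain ⟨s, rfl, hs, hinj, hsurj⟩ := E.exists_link h₀.adj_left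
  rw [hu] at hinj
  obtain rfl : s 1 = z₁ := (hs 0).unique_right h₀
  obtain rfl : s 2 = z₂ := (hs 1).unique_right h₁
  obtain rfl : s 3 = z₃ := (hs 2).unique_right h₂
  obtain rfl : s 4 = z₄ := (hs 3).unique_right h₃
  refine ⟨?_, ?_, fun x hx => ?_⟩
  · rw [(hinj 0 5).2 (by norm_num)]
    exact hs 4
  · simp [hinj]
  · obtain ⟨i, rfl⟩ := (hsurj x).1 hx
    simp only [hinj]
    omega

end PlaneEmbedding

/-! ### Rings around the poles and the antiprism -/

/-- The neighbours `v i` of a pole `a` in cyclic order, all of degree five, and their remaining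
neighbours `p i`. -/
structure PoleRing (E : PlaneEmbedding G) (a : V) (v p : ℤ → V) : Prop where
  next_pole : ∀ i, E.Next a (v i) (v (i + 1))
  eq_iff : ∀ i j, v i = v j ↔ (G.degree a : ℤ) ∣ i - j
  adj_pole_iff : ∀ x, G.Adj a x ↔ ∃ i, v i = x
  next₀ : ∀ i, E.Next (v i) (v (i + 1)) a
  next₁ : ∀ i, E.Next (v i) a (v (i - 1))
  next₂ : ∀ i, E.Next (v i) (v (i - 1)) (p i)
  next₃ : ∀ i, E.Next (v i) (p i) (p (i + 1))
  next₄ : ∀ i, E.Next (v i) (p (i + 1)) (v (i + 1))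
  degree_ring : ∀ i, G.degree (v i) = 5

theorem exists_poleRing {E : PlaneEmbedding G} (hE : E.IsTriangulation) {a z : V} (hz : G.Adj a z)
    (hdeg : ∀ x, G.Adj a x → G.degree x = 5) : ∃ v p : ℤ → V, v 0 = z ∧ PoleRing E a v p := by
  obtain ⟨v, hv0, hv, hinj, hsurj⟩ := E.exists_link hz
  have h5 : ∀ i, G.degree (v i) = 5 := fun i => hdeg _ ((hsurj _).2 ⟨i, rfl⟩)
  have n0 : ∀ i, E.Next (v i) (v (i + 1)) a := fun i => ((hv i).rotate hE).rotate hE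
  have n1 : ∀ i, E.Next (v i) a (v (i - 1)) := fun i => by
    have := (hv (i - 1)).rotate hE
    rwa [sub_add_cancel] at this
  choose p hp using fun i => E.exists_next (n1 i).adj_right
  choose q hq using fun i => E.exists_next (hp i).adj_right
  have n4 : ∀ i, E.Next (v i) (q i) (v (i + 1)) := fun i =>
    (PlaneEmbedding.next_of_degree_five (h5 i) (n0 i) (n1 i) (hp i) (hq i)).1
  -- The face across the ring edge `v i v (i + 1)` has a single third vertex.
  have hpq : ∀ i, q i = p (i + 1) := fun i => by
    have h := hp (i + 1)
    rw [add_sub_cancel_right] at h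
    exact ((n4 i).rotate hE).unique_right h
  refine ⟨v, p, hv0, hv, hinj, hsurj, n0, n1, hp, fun i => ?_, fun i => ?_, h5⟩
  · rw [← hpq]
    exact hq i
  · rw [← hpq]
    exact n4 i

namespace PoleRing

variable {E : PlaneEmbedding G} {a : V} {v p : ℤ → V}

theorem adj_pole (h : PoleRing E a v p) (i : ℤ) : G.Adj a (v i) := (h.next_pole i).adj_left

theorem eq_of_adj (h : PoleRing E a v p) {i : ℤ} {x : V} (hx : G.Adj (v i) x) :
    x = v (i + 1) ∨ x = a ∨ x = v (i - 1) ∨ x = p i ∨ x = p (i + 1) :=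
  (PlaneEmbedding.next_of_degree_five (h.degree_ring i) (h.next₀ i) (h.next₁ i) (h.next₂ i)
    (h.next₃ i)).2.2 x hx

theorem nodup (h : PoleRing E a v p) (i : ℤ) :
    [v (i + 1), a, v (i - 1), p i, p (i + 1)].Nodup :=
  (PlaneEmbedding.next_of_degree_five (h.degree_ring i) (h.next₀ i) (h.next₁ i) (h.next₂ i)
    (h.next₃ i)).2.1

/-- A chord of the ring would propagate to the next pair of vertices of the ring. -/
theorem chord_step (hE : E.IsTriangulation) (h : PoleRing E a v p) {i j : ℤ}
    (hij : p (i + 1) = v j) : v j ≠ v i ∧ v j ≠ v (i + 1) ∧ p i = v (j + 1) := by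
  have hi : G.Adj (v i) (v j) := hij ▸ (h.next₃ i).adj_right
  have hi1 : G.Adj (v (i + 1)) (v j) := hij ▸ (h.next₃ (i + 1)).adj_left
  have d0 := h.nodup i
  have d1 := h.nodup (i + 1)
  rw [hij] at d0 d1
  simp only [add_sub_cancel_right, List.nodup_cons, List.mem_cons, List.not_mem_nil, or_false,
    not_or] at d0 d1
  have hne2 : v j ≠ v (i + 1 + 1) := fun e => d1.1.2.2.1 e.symm
  have hne1 : v j ≠ v (i - 1) := fun e => d0.2.2.1.2 e.symm
  have shift : ∀ {k l : ℤ} (m : ℤ), v k = v l → v (k + m) = v (l + m) := by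
    intro k l m e
    rw [h.eq_iff] at e ⊢
    rwa [add_sub_add_right_eq_sub]
  refine ⟨hi.ne', hi1.ne', ?_⟩
  have t : E.Next (v j) (v (i + 1)) (v i) := by
    have := h.next₄ i
    rw [hij] at this
    exact (this.rotate hE).rotate hE
  -- Around `v j`, `v (i + 1)` is followed by `v i`; of the five places in its rotation only `p j`,
  -- or a coincidence giving the same conclusion, is possible.
  have hpj : p (j + 1) = v i := by
    rcases h.eq_of_adj t.adj_left with e | e | e | e | e
    · exact absurd (by simpa using shift (-1) e) hi.ne
    · exact absurd (h.adj_pole (i + 1)) (e ▸ G.irrefl)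
    · exact absurd (by simpa using (shift 1 e).symm) hne2
    · exact (h.next₃ j).unique_right (e ▸ t)
    · have t' := h.next₄ j
      rw [← e] at t'
      have := t.unique_right t'
      exact absurd (by simpa [← sub_eq_add_neg] using (shift (-1) this).symm) hne1
  have t2 := h.next₄ j
  rw [hpj] at t2
  have t3 := h.next₃ i
  rw [hij] at t3
  exact t3.unique_left ((t2.rotate hE).rotate hE)

/-- A chord propagates by `chord_step` to `p (i - k) = v (j + k)` for all `k`. The two ends run
towards each other around the ring until they coincide or are consecutive, which `chord_step`
forbids. -/
theorem no_chord (hE : E.IsTriangulation) (h : PoleRing E a v p) (i : ℤ) : ¬ G.Adj a (p i) := by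
  intro hadj
  obtain ⟨j, hj⟩ := (h.adj_pole_iff _).1 hadj
  have ladder : ∀ k : ℕ, p (i - k) = v (j + k) := by
    intro k
    induction k with
    | zero => simpa using hj.symm
    | succ k ih =>
      have := (h.chord_step hE (i := i - k - 1) (j := j + k) (by simpa using ih)).2.2
      push_cast
      rw [← sub_sub, ← add_assoc]
      exact this
  have hn : (0 : ℤ) < G.degree a := by
    have : 0 < G.degree a := (G.degree_pos_iff_exists_adj a).2 ⟨_, hadj⟩
    exact_mod_cast this
  set n : ℤ := (G.degree a : ℤ)
  -- A nonnegative representative of the gap modulo the ring length; its parity decides how the ends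
  -- meet.
  set D : ℤ := i - 1 - j + 2 * n * |i - 1 - j| with hD
  have hD0 : 0 ≤ D := by
    have h1 := neg_abs_le (i - 1 - j)
    have h2 := abs_nonneg (i - 1 - j)
    nlinarith
  have step : ∀ k : ℕ, v (j + k) ≠ v (i - 1 - k) ∧ v (j + k) ≠ v (i - 1 - k + 1) := fun k =>
    have := h.chord_step hE (i := i - 1 - k) (j := j + k) (by
      rw [← ladder k]
      congr 1
      ring)
    ⟨this.1, this.2.1⟩
  rcases Int.even_or_odd' D with ⟨m, hm | hm⟩
  · obtain ⟨k, rfl⟩ := Int.eq_ofNat_of_zero_le (show 0 ≤ m by omega)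
    refine (step k).1 ((h.eq_iff _ _).2 ⟨2 * |i - 1 - j|, ?_⟩)
    linear_combination (-1 : ℤ) * hm + hD
  · obtain ⟨k, hk⟩ := Int.eq_ofNat_of_zero_le (show 0 ≤ m + 1 by omega)
    refine (step k).2 ((h.eq_iff _ _).2 ⟨2 * |i - 1 - j|, ?_⟩)
    linear_combination (-1 : ℤ) * hm + hD - 2 * hk

end PoleRing

/-- The graph between the two poles is the antiprism over an `n`-gon. -/
theorem IsGn.exists_rings {n : ℕ} (hn : 3 ≤ n) {a b : V} (hG : IsGn n G a b) :
    ∃ v w : ℤ → V, (∀ i j, v i = v j ↔ (n : ℤ) ∣ i - j) ∧ (∀ i j, w i = w j ↔ (n : ℤ) ∣ i - j) ∧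
      (∀ x, G.Adj a x ↔ ∃ i, v i = x) ∧ (∀ x, G.Adj b x ↔ ∃ i, w i = x) ∧
      (∀ x, x = a ∨ x = b ∨ (∃ i, v i = x) ∨ ∃ i, w i = x) ∧
      (∀ i x, G.Adj (v i) x ↔ x = a ∨ x = v (i - 1) ∨ x = v (i + 1) ∨ x = w i ∨ x = w (i + 1)) ∧
      (∀ i j, G.Adj (w i) (w j) ↔ w j = w (i - 1) ∨ w j = w (i + 1)) := by
  obtain ⟨E, hE⟩ := hG.triangulation
  have hdis : ∀ x, G.Adj a x → ¬ G.Adj b x := fun x h1 h2 =>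
    Set.disjoint_left.1 hG.disjoint_nbrs h1 h2
  have hcover : ∀ x, x = a ∨ x = b ∨ G.Adj a x ∨ G.Adj b x := by
    have hd : Disjoint (G.neighborFinset a) (G.neighborFinset b) := by
      rw [Finset.disjoint_left]
      intro x h1 h2
      exact hdis x (by simpa using h1) (by simpa using h2)
    have h1 : (insert a (insert b (G.neighborFinset a ∪ G.neighborFinset b))).card =
        Fintype.card V := by
      rw [Finset.card_insert_of_notMem, Finset.card_insert_of_notMem,
        Finset.card_union_of_disjoint hd, G.card_neighborFinset_eq_degree,
        G.card_neighborFinset_eq_degree, hG.degree_a, hG.degree_b, hG.card_eq]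
      · ring
      · simp [hG.poles_not_adj]
      · simp [hG.poles_not_adj, hG.poles_ne, G.adj_comm b a]
    have h2 := (Finset.card_eq_iff_eq_univ _).1 h1
    intro x
    have := h2 ▸ Finset.mem_univ x
    simpa using this
  have hdega : ∀ x, G.Adj a x → G.degree x = 5 := fun x hx =>
    hG.degree_other x hx.ne' (fun e => hG.poles_not_adj (e ▸ hx))
  have hdegb : ∀ x, G.Adj b x → G.degree x = 5 := fun x hx =>
    hG.degree_other x (fun e => hG.poles_not_adj (e ▸ hx).symm) hx.ne'
  obtain ⟨z, hz⟩ := (G.degree_pos_iff_exists_adj a).1 (by rw [hG.degree_a]; omega)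
  obtain ⟨v, p, -, R⟩ := exists_poleRing hE hz hdega
  have hpb : ∀ i, G.Adj b (p i) := by
    intro i
    have hadj := (R.next₃ i).adj_left
    rcases hcover (p i) with e | e | e | e
    · have := R.nodup i
      simp [e] at this
    · exact absurd (e ▸ hadj.symm) (hdis _ (R.adj_pole i))
    · exact absurd e (R.no_chord hE i)
    · exact e
  obtain ⟨u, q, hu0, Q⟩ := exists_poleRing hE (hpb 0) hdegb
  have hqa : ∀ j, G.Adj a (q j) := by
    intro i
    have hadj := (Q.next₃ i).adj_left
    rcases hcover (q i) with e | e | e | e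
    · exact absurd (Q.adj_pole i) (hdis _ (e ▸ hadj.symm))
    · have := Q.nodup i
      simp [e] at this
    · exact e
    · exact absurd e (Q.no_chord hE i)
  have hba : ¬ G.Adj b a := fun h => hG.poles_not_adj h.symm
  -- The rings run in opposite senses: if `p (i + 1)` were `u (j + 1)`, the pole `b` would follow it
  -- around `u j` in place of `v i`.
  have step : ∀ i j, p i = u j → p (i + 1) = u (j - 1) := by
    intro i j hij
    have t := (R.next₃ i).rotate hE |>.rotate hE
    rw [hij] at t
    rcases Q.eq_of_adj t.adj_left with e | e | e | e | e
    · have := t.unique_right (e ▸ Q.next₀ j)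
      exact absurd (this ▸ R.adj_pole i) (fun h => hba h.symm)
    · exact absurd (e ▸ hpb (i + 1)) G.irrefl
    · exact e
    · exact absurd (hpb (i + 1)) (e ▸ hdis _ (hqa _))
    · exact absurd (hpb (i + 1)) (e ▸ hdis _ (hqa _))
  have hbn : (G.degree b : ℤ) = n := by rw [hG.degree_b]
  have han : (G.degree a : ℤ) = n := by rw [hG.degree_a]
  have steps : ∀ i j, p i = u j → ∀ k : ℕ, p (i + k) = u (j - k) := by
    intro i j hij k
    induction k with
    | zero => simpa using hij
    | succ k ih =>
      push_cast
      rw [← add_assoc, ← sub_sub]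
      exact step _ _ ih
  have pu : ∀ i, p i = u (-i) := by
    intro i
    rcases Int.eq_nat_or_neg i with ⟨k, rfl | rfl⟩
    · simpa using steps 0 0 hu0.symm k
    -- `steps` only goes forward, so walk from `p (-k)` up to `p 0 = u 0`.
    · obtain ⟨j, hj⟩ := (Q.adj_pole_iff _).1 (hpb (-k))
      have h0 := steps _ _ hj.symm k
      rw [neg_add_cancel, ← hu0, Q.eq_iff] at h0
      rw [← hj, Q.eq_iff]
      rw [show j - - -(k : ℤ) = -(0 - (j - k)) by ring]
      exact (dvd_neg).2 h0
  have hpp : ∀ i, G.Adj (p i) (p (i + 1)) := fun i =>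
    ((R.next₃ i).rotate hE |>.rotate hE).adj_left
  refine ⟨v, p, fun i j => han ▸ R.eq_iff i j, fun i j => ?_, R.adj_pole_iff, fun x => ?_,
    fun x => ?_, fun i x => ⟨fun h => ?_, ?_⟩, fun i j => ⟨fun h => ?_, ?_⟩⟩
  · rw [pu, pu, Q.eq_iff, hbn, ← dvd_neg]
    congr! 1
    ring
  · rw [Q.adj_pole_iff]
    constructor
    · rintro ⟨i, rfl⟩
      exact ⟨-i, by rw [pu, neg_neg]⟩
    · rintro ⟨i, rfl⟩
      exact ⟨-i, (pu i).symm⟩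
  · rcases hcover x with h | h | h | h
    · exact Or.inl h
    · exact Or.inr (Or.inl h)
    · exact Or.inr (Or.inr (Or.inl ((R.adj_pole_iff x).1 h)))
    · obtain ⟨i, rfl⟩ := (Q.adj_pole_iff x).1 h
      exact Or.inr (Or.inr (Or.inr ⟨-i, by rw [pu, neg_neg]⟩))
  · rcases R.eq_of_adj h with h | h | h | h | h <;> simp [h]
  · rintro (rfl | rfl | rfl | rfl | rfl)
    · exact (R.adj_pole i).symm
    · exact (R.next₂ i).adj_left
    · exact (R.next₀ i).adj_left
    · exact (R.next₃ i).adj_left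
    · exact (R.next₄ i).adj_left
  · rw [pu i] at h
    rcases Q.eq_of_adj h with e | e | e | e | e
    · left
      rw [e, pu]
      congr 1
      ring
    · exact absurd (e ▸ hpb j) G.irrefl
    · right
      rw [e, pu]
      congr 1
      ring
    · exact absurd (hpb j) (e ▸ hdis _ (hqa _))
    · exact absurd (hpb j) (e ▸ hdis _ (hqa _))
  · rintro (e | e)
    · rw [e]
      simpa using (hpp (i - 1)).symm
    · rw [e]
      exact hpp i

/-! ### From colourings to zigzag words -/

theorem perm_eq_of_eq_three {P Q : Equiv.Perm (Fin 4)} {x y z : Fin 4} (hxy : x ≠ y) (hxz : x ≠ z)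
    (hyz : y ≠ z) (hx : P x = Q x) (hy : P y = Q y) (hz : P z = Q z) : P = Q := by
  have key : ∀ t u : Fin 4, t ≠ x → t ≠ y → t ≠ z → u ≠ x → u ≠ y → u ≠ z → t = u := by
    clear hx hy hz
    revert x y z
    decide
  ext t : 1
  by_cases h1 : t = x
  · rw [h1, hx]
  by_cases h2 : t = y
  · rw [h2, hy]
  by_cases h3 : t = z
  · rw [h3, hz]
  have : t = P⁻¹ (Q t) := by
    refine key _ _ h1 h2 h3 ?_ ?_ ?_ <;> rw [Ne, Equiv.Perm.inv_eq_iff_eq, eq_comm]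
    · rw [hx, Q.injective.eq_iff]; exact Ne.symm h1
    · rw [hy, Q.injective.eq_iff]; exact Ne.symm h2
    · rw [hz, Q.injective.eq_iff]; exact Ne.symm h3
  exact (Equiv.Perm.eq_inv_iff_eq).1 this

/-- A graph with a triangle has `24` times as many 4-colourings as classes of 4-colourings. -/
theorem card_coloring_eq {V : Type*} (G : SimpleGraph V) {x y z : V} (hxy : G.Adj x y)
    (hxz : G.Adj x z) (hyz : G.Adj y z) :
    Nat.card (G.Coloring (Fin 4)) = 24 * numColourings G := by
  let f : Equiv.Perm (Fin 4) × Quotient (colouringSetoid G) → G.Coloring (Fin 4) := fun c =>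
    SimpleGraph.Coloring.mk (fun v => c.1 (c.2.out v)) fun {_ _} h => by
      simpa using c.2.out.valid h
  have hf : Function.Bijective f := by
    constructor
    · rintro ⟨P, q⟩ ⟨Q, r⟩ h
      have h' : ∀ v, P (q.out v) = Q (r.out v) := fun v => DFunLike.congr_fun h v
      have hqr : q = r := by
        rw [← Quotient.out_equiv_out]
        exact ⟨P⁻¹ * Q, fun v => by
          rw [Equiv.Perm.mul_apply, ← h' v, Equiv.Perm.eq_inv_iff_eq]⟩
      subst hqr
      rw [perm_eq_of_eq_three (q.out.valid hxy) (q.out.valid hxz) (q.out.valid hyz) (h' x) (h' y)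
        (h' z)]
    · intro A
      obtain ⟨P, hP⟩ := (colouringSetoid G).symm (Quotient.mk_out (s := colouringSetoid G) A)
      exact ⟨(P, Quotient.mk _ A), by ext v : 1; exact (hP v).symm⟩
  rw [← Nat.card_congr (Equiv.ofBijective f hf), Nat.card_prod, numColourings]
  simp [Fintype.card_perm, Nat.factorial]

/-- The conditions on the colours `p` of a pair `w i`, `v i` and the colours `q` of the next pair
`w (i + 1)`, `v (i + 1)` if the poles have the colours `ca` and `cb`. -/
def RingRel (ca cb : Fin 4) (p q : Fin 4 × Fin 4) : Prop :=
  p.1 ≠ cb ∧ p.2 ≠ ca ∧ p.1 ≠ p.2 ∧ p.2 ≠ q.1 ∧ p.1 ≠ q.1 ∧ p.2 ≠ q.2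

theorem compatible_comm (s : Bool) (x y : Fin 3) : Compatible s x y ↔ Compatible s y x := by
  revert s x y
  decide

/-- Each ring has three available colours. Symbols `0`, `1` name colours shared by both rings, and
so does `2` when the poles agree; otherwise `2` is the colour of the opposite pole. -/
theorem exists_symbols (ca cb : Fin 4) : ∃ e₁ e₂ : Fin 3 → Fin 4,
    e₁.Injective ∧ e₂.Injective ∧ (∀ t, t ≠ cb ↔ ∃ x, e₁ x = t) ∧ (∀ t, t ≠ ca ↔ ∃ x, e₂ x = t) ∧
      ∀ x y, e₁ x ≠ e₂ y ↔ Compatible (decide (ca ≠ cb)) x y := by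
  have hP : ∃ P : Equiv.Perm (Fin 4), P 3 = ca ∧ (ca ≠ cb → P 2 = cb) := by
    revert ca cb
    decide
  obtain ⟨P, h3, h2⟩ := hP
  have key : ∃ e₁ e₂ : Fin 3 → Fin 4,
    e₁.Injective ∧ e₂.Injective ∧ (∀ t, t ≠ (if ca ≠ cb then 2 else 3) ↔ ∃ x, e₁ x = t) ∧
      (∀ t, t ≠ 3 ↔ ∃ x, e₂ x = t) ∧
      ∀ x y, e₁ x ≠ e₂ y ↔ Compatible (decide (ca ≠ cb)) x y := by
    by_cases h : ca = cb
    · refine ⟨![0, 1, 2], ![0, 1, 2], ?_⟩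
      simp only [h, ne_eq, not_true_eq_false, if_false, decide_false]
      decide
    -- Normalised to `ca = 3`, `cb = 2`: the `w` ring avoids 2, the `v` ring avoids 3.
    · refine ⟨![0, 1, 3], ![0, 1, 2], ?_⟩
      simp only [h, ne_eq, not_false_eq_true, if_true, decide_true]
      decide
  obtain ⟨e₁, e₂, i₁, i₂, r₁, r₂, hc⟩ := key
  have hb : P (if ca ≠ cb then 2 else 3) = cb := by
    split_ifs with h
    · exact h2 h
    · rw [h3]
      exact not_not.1 h
  refine ⟨P ∘ e₁, P ∘ e₂, P.injective.comp i₁, P.injective.comp i₂, fun t => ?_, fun t => ?_,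
    fun x y => ?_⟩
  · have := r₁ (P⁻¹ t)
    rw [Ne, Equiv.Perm.inv_eq_iff_eq, hb] at this
    simpa only [Equiv.Perm.eq_inv_iff_eq, Function.comp_apply, ne_eq] using this
  · have := r₂ (P⁻¹ t)
    rw [Ne, Equiv.Perm.inv_eq_iff_eq, h3] at this
    simpa only [Equiv.Perm.eq_inv_iff_eq, Function.comp_apply, ne_eq] using this
  · rw [← hc]
    simp

theorem card_ring_eq (m : ℕ) (ca cb : Fin 4) :
    (Nat.card {c : Fin (m + 1) → Fin 4 × Fin 4 // ∀ i, RingRel ca cb (c i) (c (i + 1))} : ℤ) =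
      (zigzag (decide (ca ≠ cb)) ^ (2 * (m + 1))).trace := by
  rw [pow_mul, zigzag_sq, trace_pow_eq_card]
  obtain ⟨e₁, e₂, i₁, i₂, r₁, r₂, hc⟩ := exists_symbols ca cb
  have hrel : ∀ p q : Fin 3 × Fin 3, RingRel ca cb (e₁ p.1, e₂ p.2) (e₁ q.1, e₂ q.2) ↔
      Compatible (decide (ca ≠ cb)) p.1 p.2 ∧ Compatible (decide (ca ≠ cb)) p.2 q.1 ∧
        p.1 ≠ q.1 ∧ p.2 ≠ q.2 := by
    intro p q
    have h1 : e₁ p.1 ≠ cb := (r₁ _).2 ⟨_, rfl⟩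
    have h2 : e₂ p.2 ≠ ca := (r₂ _).2 ⟨_, rfl⟩
    simp only [RingRel, h1, h2, hc, i₁.ne_iff, i₂.ne_iff, true_and, ne_eq, not_false_eq_true]
    rw [compatible_comm _ p.2 q.1, ← hc q.1 p.2, ne_comm]
  congr 1
  symm
  let f : {c : Fin (m + 1) → Fin 3 × Fin 3 //
      ∀ i, ZigzagRel (decide (ca ≠ cb)) (c i) (c (i + 1))} →
      {c : Fin (m + 1) → Fin 4 × Fin 4 // ∀ i, RingRel ca cb (c i) (c (i + 1))} := fun c =>
    ⟨fun i => (e₁ (c.1 i).1, e₂ (c.1 i).2), fun i =>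
      (hrel _ _).2 ⟨(c.2 i).1, (c.2 i).2.1, (c.2 i).2.2.2.1, (c.2 i).2.2.2.2⟩⟩
  refine Nat.card_congr (Equiv.ofBijective f ⟨?_, ?_⟩)
  · rintro ⟨c, hc1⟩ ⟨d, hd⟩ h
    refine Subtype.ext (funext fun i => ?_)
    have := congrFun (Subtype.ext_iff.1 h) i
    exact Prod.ext (i₁ (congrArg Prod.fst this)) (i₂ (congrArg Prod.snd this))
  · rintro ⟨c, hc1⟩
    choose x hx using fun i => (r₁ (c i).1).1 (hc1 i).1
    choose y hy using fun i => (r₂ (c i).2).1 (hc1 i).2.1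
    have hcxy : ∀ i, c i = (e₁ (x i), e₂ (y i)) := fun i => by rw [hx, hy]
    have hz := fun i => (hrel (x i, y i) (x (i + 1), y (i + 1))).1
      (by simpa only [← hcxy] using hc1 i)
    exact ⟨⟨fun i => (x i, y i), fun i => ⟨(hz i).1, (hz i).2.1, (hz (i + 1)).1, (hz i).2.2.1,
      (hz i).2.2.2⟩⟩, Subtype.ext (funext fun i => (hcxy i).symm)⟩

/-- Links the integer indexing of the rings to the cyclic `Fin` indexing of the words; `φ` is
reduction to `ZMod (m + 1)`, which unfolds to `Fin (m + 1)`. -/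
theorem exists_residue (m : ℕ) : ∃ φ : ℤ → Fin (m + 1), (∀ j, φ (j + 1) = φ j + 1) ∧
    (∀ j k, φ j = φ k ↔ ((m + 1 : ℕ) : ℤ) ∣ j - k) ∧ ∀ i, ∃ j, φ j = i := by
  let φ : ℤ → ZMod (m + 1) := fun j => j
  have h1 : ∀ j, φ (j + 1) = φ j + 1 := fun j => by simp [φ]
  have h2 : ∀ j k, φ j = φ k ↔ ((m + 1 : ℕ) : ℤ) ∣ j - k := fun j k => by
    rw [dvd_sub_comm]
    exact ZMod.intCast_eq_intCast_iff_dvd_sub j k (m + 1)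
  have h3 : φ.Surjective := ZMod.intCast_surjective
  exact ⟨φ, h1, h2, h3⟩

theorem IsGn.card_coloring_eq_card_ring {m : ℕ} (hm : 2 ≤ m) {a b : V} (hG : IsGn (m + 1) G a b) :
    Nat.card (G.Coloring (Fin 4)) = Nat.card {x : (Fin 4 × Fin 4) × (Fin (m + 1) → Fin 4 × Fin 4) //
      ∀ i, RingRel x.1.1 x.1.2 (x.2 i) (x.2 (i + 1))} := by
  classical
  obtain ⟨v, w, hv, hw, ha, hb, hcov, hvadj, hwadj⟩ := hG.exists_rings (by omega)
  obtain ⟨φ, hφ1, hφ, hφs⟩ := exists_residue m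
  choose ψ hψ using hφs
  have hdvd : ∀ j, ((m + 1 : ℕ) : ℤ) ∣ ψ (φ j) - j := fun j => (hφ _ _).1 (hψ _)
  have hvψ : ∀ j, v (ψ (φ j)) = v j := fun j => (hv _ _).2 (hdvd j)
  have hwψ : ∀ j, w (ψ (φ j)) = w j := fun j => (hw _ _).2 (hdvd j)
  have hψ1 : ∀ i, φ (ψ i + 1) = i + 1 := fun i => by rw [hφ1, hψ]
  have hv1 : ∀ i, v (ψ (i + 1)) = v (ψ i + 1) := fun i => by rw [← hψ1, hvψ]
  have hw1 : ∀ i, w (ψ (i + 1)) = w (ψ i + 1) := fun i => by rw [← hψ1, hwψ]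
  have av : ∀ i, G.Adj a (v i) := fun i => (ha _).2 ⟨i, rfl⟩
  have bw : ∀ i, G.Adj b (w i) := fun i => (hb _).2 ⟨i, rfl⟩
  have vv : ∀ i, G.Adj (v i) (v (i + 1)) := fun i => (hvadj _ _).2 (by simp)
  have vw : ∀ i, G.Adj (v i) (w i) := fun i => (hvadj _ _).2 (by simp)
  have vw1 : ∀ i, G.Adj (v i) (w (i + 1)) := fun i => (hvadj _ _).2 (by simp)
  have ww : ∀ i, G.Adj (w i) (w (i + 1)) := fun i => (hwadj _ _).2 (by simp)
  let f : G.Coloring (Fin 4) → {x : (Fin 4 × Fin 4) × (Fin (m + 1) → Fin 4 × Fin 4) //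
      ∀ i, RingRel x.1.1 x.1.2 (x.2 i) (x.2 (i + 1))} := fun A =>
    ⟨((A a, A b), fun i => (A (w (ψ i)), A (v (ψ i)))), fun i => by
      simp only [RingRel, hv1, hw1]
      exact ⟨(A.valid (bw _)).symm, (A.valid (av _)).symm, (A.valid (vw _)).symm,
        A.valid (vw1 _), A.valid (ww _), A.valid (vv _)⟩⟩
  refine Nat.card_congr (Equiv.ofBijective f ⟨fun A B h => ?_, ?_⟩)
  · obtain ⟨h1, h2⟩ := Prod.ext_iff.1 (Subtype.ext_iff.1 h)
    ext x : 1
    rcases hcov x with rfl | rfl | ⟨j, rfl⟩ | ⟨j, rfl⟩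
    · exact congrArg Prod.fst h1
    · exact congrArg Prod.snd h1
    · have := congrArg Prod.snd (congrFun h2 (φ j))
      simpa only [f, hvψ] using this
    · have := congrArg Prod.fst (congrFun h2 (φ j))
      simpa only [f, hwψ] using this
  · rintro ⟨⟨⟨ca, cb⟩, c⟩, hc⟩
    have hr : ∀ j, RingRel ca cb (c (φ j)) (c (φ (j + 1))) := fun j => hφ1 j ▸ hc (φ j)
    have nva : ∀ i, v i ≠ a := fun i => (av i).ne'
    have nwb : ∀ i, w i ≠ b := fun i => (bw i).ne'
    have nvb : ∀ i, v i ≠ b := fun i e => hG.poles_not_adj (e ▸ av i)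
    have nwa : ∀ i, w i ≠ a := fun i e => hG.poles_not_adj (e ▸ bw i).symm
    have nwv : ∀ i j, v j ≠ w i := fun i j e =>
      Set.disjoint_left.1 hG.disjoint_nbrs (av j) (show G.Adj b (v j) from e ▸ bw i)
    -- The final value 0 is never reached, because poles and rings cover all vertices.
    let A : V → Fin 4 := fun x => if x = a then ca else if x = b then cb else
      if h : ∃ i, v i = x then (c (φ h.choose)).2 else
      if h : ∃ i, w i = x then (c (φ h.choose)).1 else 0
    have Aa : A a = ca := by simp [A]
    have Ab : A b = cb := by simp [A, hG.poles_ne.symm]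
    have Av : ∀ j, A (v j) = (c (φ j)).2 := by
      intro j
      have h : ∃ i, v i = v j := ⟨j, rfl⟩
      simp only [A, nva, nvb, if_false, dif_pos h]
      rw [(hφ _ _).2 ((hv _ _).1 h.choose_spec)]
    have Aw : ∀ j, A (w j) = (c (φ j)).1 := by
      intro j
      have h : ∃ i, w i = w j := ⟨j, rfl⟩
      have h' : ¬ ∃ i, v i = w j := fun ⟨i, e⟩ => nwv _ _ e
      simp only [A, nwa, nwb, if_false, dif_neg h', dif_pos h]
      rw [(hφ _ _).2 ((hw _ _).1 h.choose_spec)]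
    have properV : ∀ i x, G.Adj (v i) x → A (v i) ≠ A x := by
      intro i x hx
      have h0 := hr (i - 1)
      have h1 := hr i
      rw [sub_add_cancel] at h0
      rcases (hvadj i x).1 hx with rfl | rfl | rfl | rfl | rfl
      · rw [Av, Aa]
        exact h1.2.1
      · rw [Av, Av]
        exact h0.2.2.2.2.2.symm
      · rw [Av, Av]
        exact h1.2.2.2.2.2
      · rw [Av, Aw]
        exact h1.2.2.1.symm
      · rw [Av, Aw]
        exact h1.2.2.2.1
    have properB : ∀ x, G.Adj b x → A b ≠ A x := by
      intro x hx
      obtain ⟨i, rfl⟩ := (hb x).1 hx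
      rw [Ab, Aw]
      exact (hr i).1.symm
    have proper : ∀ {x y}, G.Adj x y → A x ≠ A y := by
      intro x y hxy
      rcases hcov x with rfl | rfl | ⟨i, rfl⟩ | ⟨i, rfl⟩
      · obtain ⟨j, rfl⟩ := (ha y).1 hxy
        exact (properV j _ hxy.symm).symm
      · exact properB _ hxy
      · exact properV i _ hxy
      · rcases hcov y with rfl | rfl | ⟨j, rfl⟩ | ⟨j, rfl⟩
        · obtain ⟨j, e⟩ := (ha _).1 hxy.symm
          exact absurd e (nwv _ _)
        · exact (properB _ hxy.symm).symm
        · exact (properV j _ hxy.symm).symm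
        · have h0 := hr (i - 1)
          have h1 := hr i
          rw [sub_add_cancel] at h0
          rcases (hwadj i j).1 hxy with e | e
          · rw [e, Aw, Aw]
            exact h0.2.2.2.2.1.symm
          · rw [e, Aw, Aw]
            exact h1.2.2.2.2.1
    refine ⟨SimpleGraph.Coloring.mk A proper, Subtype.ext (Prod.ext (Prod.ext Aa Ab)
      (funext fun i => ?_))⟩
    change (A (w (ψ i)), A (v (ψ i))) = c i
    rw [Aw, Av, hψ]

theorem IsGn.numColourings_eq {n : ℕ} (hn : 3 ≤ n) {a b : V} (hG : IsGn n G a b) :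
    (24 * numColourings G : ℤ) =
      4 * (zigzag false ^ (2 * n)).trace + 12 * (zigzag true ^ (2 * n)).trace := by
  obtain ⟨m, rfl⟩ : ∃ m, n = m + 1 := ⟨n - 1, by omega⟩
  obtain ⟨v, w, hv, hw, ha, hb, hcov, hvadj, hwadj⟩ := hG.exists_rings hn
  have h := card_coloring_eq G ((ha _).2 ⟨0, rfl⟩) ((ha _).2 ⟨1, rfl⟩) ((hvadj 0 (v 1)).2 (by simp))
  rw [hG.card_coloring_eq_card_ring (by omega),
    Nat.card_congr (Equiv.subtypeProdEquivSigmaSubtype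
      fun (x : Fin 4 × Fin 4) (c : Fin (m + 1) → Fin 4 × Fin 4) =>
        ∀ i, RingRel x.1 x.2 (c i) (c (i + 1))), Nat.card_sigma] at h
  have h' : ((∑ x : Fin 4 × Fin 4, Nat.card {c : Fin (m + 1) → Fin 4 × Fin 4 //
      ∀ i, RingRel x.1 x.2 (c i) (c (i + 1))} : ℕ) : ℤ) = 24 * numColourings G := by
    rw [h]
    push_cast
    rfl
  rw [← h']
  push_cast
  simp only [card_ring_eq]
  simp [Fintype.sum_prod_type, Fin.sum_univ_four]
  ring

end KempePoles

theorem theorem1p3 (n : ℕ) (hn : 3 ≤ n) {V : Type*} [Fintype V] [DecidableEq V]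
    (G : SimpleGraph V) [DecidableRel G.Adj] (a b : V) (hG : KempePoles.IsGn n G a b) :
    (¬ 3 ∣ n → (KempePoles.numColourings G : ℚ) =
      ∑ k ∈ Finset.range (2 * n) with n ≤ 2 * k ∧ 3 * k < 2 * n,
        (Nat.choose k (2 * n - 3 * k) : ℚ) * ((n : ℚ) * 2 ^ (2 * n - 3 * k) / (k : ℚ))) ∧
    (3 ∣ n → (KempePoles.numColourings G : ℚ) =
      (∑ k ∈ Finset.range (2 * n) with n ≤ 2 * k ∧ 3 * k < 2 * n,
        (Nat.choose k (2 * n - 3 * k) : ℚ) * ((n : ℚ) * 2 ^ (2 * n - 3 * k) / (k : ℚ))) + 4) := by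
  have h := hG.numColourings_eq hn
  have hf := KempePoles.trace_zigzag_false (2 * n - 1)
  have ht := KempePoles.trace_zigzag_true (2 * n - 4)
  have hs := KempePoles.three_mul_tilings_add n hn
  have h3 : 3 ∣ 2 * n ↔ 3 ∣ n := by omega
  rw [show 2 * n - 1 + 1 = 2 * n by omega] at hf
  rw [show 2 * n - 4 + 4 = 2 * n by omega] at ht
  rw [hf, ht] at h
  simp only [h3] at h
  have h' : (24 * KempePoles.numColourings G : ℚ) = 4 * (if 3 ∣ n then 6 else 0) +
      12 * (3 * KempePoles.tilings (2 * n) + 2 * KempePoles.tilings (2 * n - 4) +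
        if 3 ∣ n then 3 else 0) := by exact_mod_cast h
  rw [hs] at h'
  constructor <;> intro hd <;> simp only [hd, if_true, if_false] at h' <;> linarith
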